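/- Let $d\ge 2$, $p\in[0,1]$, and let $\mathbb T_d$ be the rooted $d$-ary tree: the root $\varnothing$ has no parent, every other vertex has one parent, and every vertex has $d$ children. The self-similar frog model $\mathrm{SFM}(d,p)$ is the following process in discrete time. At time $0$ every vertex carries one frog; the frog at $\varnothing$ is active and all others sleep. In each time step all active frogs jump simultaneously, and a sleeping frog becomes active when its vertex is visited. Active frogs perform independent non-backtracking walks: - the frog started at $\varnothing$ always jumps to a uniformly chosen child; - any other frog first jumps to the parent with probability $p$ and to each child with probability $\frac{1-p}{d}$; - after an upward jump it jumps up again with probability $\frac{p}{p+(1-p)(d-1)/d}$, and otherwise to a uniformly chosen child other than the one it came from; - after a downward jump it jumps to a uniformly chosen child. A frog is killed when it arrives at $\varnothing$. A non-root vertex is lethal, once it has been visited, to every frog that later attempts to jump to it from its parent, and such a frog is killed; if several frogs attempt at the same moment to make the first visit to a vertex, exactly one of them, the one that comes first in an arbitrary fixed ranking of the frogs, survives. Thus every subtree consisting of a non-root vertex and its descendants is entered from outside at most once. Let $V^*_d\in\{0,1,2,\dots\}\cup\{\infty\}$ be the total number of visits to $\varnothing$ in $\mathrm{SFM}\left(d,\frac{d-1}{2d-1}\right)$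 (not counting the initial presence of the root frog), and let $g_d(x)=\mathbb E\big(x^{V^*_d}\big)$ for $x\in[0,1)$, with $x^\infty=0$. Define polynomials $P_k(z_1,\dots,z_k)$, $k\ge1$, and $Q_k(z_1,\dots,z_k)$, $k\ge2$, by $P_1=z_1$, $Q_2=z_2^2$ and $$P_{k+1}=z_{k+1}^{k+1}-\sum_{l=1}^{k}\binom{k}{l-1}z_{k+1}^{k+1-l}P_l(z_1,\dots,z_l)\quad(k\ge 1),$$ $$Q_{k+1}=z_{k+1}^{k+1}-\sum_{l=2}^{k}\binom{k-1}{l-2}z_{k+1}^{k+1-l}Q_l(z_1,\dots,z_l)\quad(k\ge 2).$$ For $d\ge2$ and $h\in\mathcal I=\{f:[0,1)\to[0,1]\ \text{nondecreasing}\}$ let, for $x\in[0,1)$, $$\mathcal A_dh(x)=\frac{(d-1)x+1}{2d-1}\sum_{k=1}^{d}\binom{d-1}{k-1}P_k(z_1,\dots,z_k)+\frac{d-1}{2d-1}\sum_{k=2}^{d}\binom{d-2}{k-2}Q_k(z_1,\dots,z_k),\qquad z_k=h\Big(\frac x2+\frac{k-1}{2(d-1)}\Big).$$ **Proposition.** For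 every $d\ge2$ one has $g_d\in\mathcal I$, and $\mathcal A_dg_d(x)\le\mathcal A_2g_d(x)$ for all $x\in[0,1)$. -/

import Mathlib

open MeasureTheory

namespace FrogModel

/-! ## The tree, the frogs' walks, and their randomness -/

/-- Vertices of the rooted `d`-ary tree: the root is `[]`, the parent of `i :: u` is `u`,
and the children of `u` are the vertices `i :: u` with `i : Fin d`. -/
abbrev Vertex (d : ℕ) : Type := List (Fin d)

/-- One jump of a frog: to the parent, or to the `i`-th child. -/
inductive Move (d : ℕ) : Type
  | up : Move d
  | down (i : Fin d) : Move d

/-- What a frog remembers of its last jump: `start` (it has not jumped yet), `cameUp c` (it jumped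
up, from the `c`-th child of its present position), `cameDown` (it jumped down). -/
inductive Last (d : ℕ) : Type
  | start : Last d
  | cameUp (c : Fin d) : Last d
  | cameDown : Last d

/-- `Move d` is a copy of `Option (Fin d)`. -/
def Move.equiv (d : ℕ) : Option (Fin d) ≃ Move d where
  toFun o := match o with
    | none => .up
    | some i => .down i
  invFun m := match m with
    | .up => none
    | .down i => some i
  left_inv o := by cases o <;> rfl
  right_inv m := by cases m <;> rfl

instance (d : ℕ) : Fintype (Move d) := Fintype.ofEquiv _ (Move.equiv d)

instance (d : ℕ) : MeasurableSpace (Move d) := ⊤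

instance (d : ℕ) : DiscreteMeasurableSpace (Move d) := ⟨fun _ => trivial⟩

/-- `Last d` is a copy of `Option (Option (Fin d))`. -/
def Last.equiv (d : ℕ) : Option (Option (Fin d)) ≃ Last d where
  toFun o := match o with
    | none => .start
    | some none => .cameDown
    | some (some c) => .cameUp c
  invFun m := match m with
    | .start => none
    | .cameDown => some none
    | .cameUp c => some (some c)
  left_inv o := by rcases o with _ | _ | _ <;> rfl
  right_inv m := by cases m <;> rfl

instance (d : ℕ) : Countable (Last d) := (Last.equiv d).symm.injective.countable

/-- Transition probabilities of a non-backtracking `p`-biased walk on the `d`-ary tree, given the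
last jump. A fresh frog goes up with probability `p` and to each child with probability `(1-p)/d`.
After an upward jump from the child `c`, it goes up with probability `p / (p + (1-p)(d-1)/d)`, and
otherwise to a uniformly chosen child other than `c`. After a downward jump it goes to a uniformly
chosen child. -/
noncomputable def stepProb (d : ℕ) (p : ℝ) : Last d → Move d → ℝ
  | .start, .up => p
  | .start, .down _ => (1 - p) / d
  | .cameUp _, .up => p / (p + (1 - p) * (d - 1) / d)
  | .cameUp c, .down i =>
      open Classical in if i = c then 0 else ((1 - p) / d) / (p + (1 - p) * (d - 1) / d)
  | .cameDown, .up => 0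
  | .cameDown, .down _ => 1 / d

theorem sum_move {d : ℕ} {M : Type*} [AddCommMonoid M] (f : Move d → M) :
    ∑ a, f a = f .up + ∑ i, f (.down i) := by
  rw [← (Move.equiv d).sum_comp, Fintype.sum_option]
  rfl

theorem stepProb_denom_pos {d : ℕ} (hd : 2 ≤ d) (p : unitInterval) :
    0 < (p : ℝ) + (1 - p) * (d - 1) / d := by
  have h2 : (2 : ℝ) ≤ d := by exact_mod_cast hd
  have hp := p.2.1
  have hp1 : 0 ≤ 1 - (p : ℝ) := by linarith [p.2.2]
  have e : (p : ℝ) + (1 - p) * (d - 1) / d = (1 + p * (d - 1) + (1 - p) * (d - 2)) / d := by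
    field_simp
    ring
  rw [e]
  have : 0 ≤ (p : ℝ) * (d - 1) := mul_nonneg hp (by linarith)
  have : 0 ≤ (1 - (p : ℝ)) * (d - 2) := mul_nonneg hp1 (by linarith)
  positivity

theorem stepProb_nonneg {d : ℕ} (hd : 2 ≤ d) (p : unitInterval) (m : Last d) (a : Move d) :
    0 ≤ stepProb d p m a := by
  have hD := stepProb_denom_pos hd p
  have hp := p.2.1
  have hp1 : 0 ≤ 1 - (p : ℝ) := by linarith [p.2.2]
  cases m <;> cases a <;> simp only [stepProb] <;> try split_ifs
  all_goals positivity

theorem sum_stepProb {d : ℕ} (hd : 2 ≤ d) (p : unitInterval) (m : Last d) :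
    ∑ a, stepProb d p m a = 1 := by
  classical
  have hD := stepProb_denom_pos hd p
  have h2 : (2 : ℝ) ≤ d := by exact_mod_cast hd
  have hd0 : (d : ℝ) ≠ 0 := by linarith
  rw [sum_move]
  cases m with
  | start => simp [stepProb]; field_simp; ring
  | cameUp c =>
    have : ∀ i : Fin d, stepProb d p (.cameUp c) (.down i)
        = (((1 - p) / d) / (p + (1 - p) * (d - 1) / d) : ℝ)
          - if i = c then (((1 - p) / d) / (p + (1 - p) * (d - 1) / d) : ℝ) else 0 := by
      intro i
      by_cases h : i = c <;> simp [stepProb, h]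
    simp only [this, Finset.sum_sub_distrib, Finset.sum_ite_eq', Finset.mem_univ, if_true]
    simp only [stepProb, Finset.sum_const, Finset.card_univ, Fintype.card_fin, nsmul_eq_mul]
    rw [← mul_div_assoc, ← sub_div, ← add_div, div_eq_one_iff_eq hD.ne']
    field_simp
  | cameDown => simp [stepProb, hd0]

/-- The law of the next jump, given the last one. -/
noncomputable def stepLaw (d : ℕ) (hd : 2 ≤ d) (p : unitInterval) (m : Last d) : PMF (Move d) :=
  PMF.ofFintype (fun a => ENNReal.ofReal (stepProb d p m a)) (by
    rw [← ENNReal.ofReal_sum_of_nonneg (fun a _ => stepProb_nonneg hd p m a), sum_stepProb hd p m,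
      ENNReal.ofReal_one])

/-- The sample space: `ω (t, v, m)` is the jump that the frog originally placed at `v` makes in the
round from time `t` to time `t + 1`, should it be active then with last jump `m`. -/
abbrev Sample (d : ℕ) : Type := ℕ × Vertex d × Last d → Move d

/-- All instructions are independent and follow the transition probabilities, so that awake frogs
perform independent non-backtracking walks. -/
noncomputable def sampleLaw (d : ℕ) (hd : 2 ≤ d) (p : unitInterval) : Measure (Sample d) :=
  Measure.infinitePi fun i : ℕ × Vertex d × Last d => (stepLaw d hd p i.2.2).toMeasure

/-! ## The self-similar frog model -/

/-- The state of one frog: asleep at its original site, active at `u` with last jump `m`,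
killed upon its arrival at the root, or killed upon a jump down to a lethal vertex. -/
inductive Status (d : ℕ) : Type
  | asleep : Status d
  | active (u : Vertex d) (m : Last d) : Status d
  | atRoot : Status d
  | dead : Status d

/-- The states of all frogs; frogs are named after the vertices where they are placed. -/
abbrev Config (d : ℕ) : Type := Vertex d → Status d

/-- At time `0` the frog at the root is active, and all others sleep. The root frog
starts with last jump `cameDown`, because it always jumps to a uniformly chosen child. -/
def initial (d : ℕ) : Config d
  | [] => .active [] .cameDown
  | _ :: _ => .asleep

/-- In the configuration `s` with the jumps `a`, the frog `f` attempts to jump from the parent of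
`w` down to `w`. -/
def Descends {d : ℕ} (s : Config d) (a : Vertex d → Last d → Move d) (f w : Vertex d) : Prop :=
  ∃ u m i, s f = .active u m ∧ a f m = .down i ∧ w = i :: u

open Classical in
/-- One round of the self-similar frog model, in which all active frogs jump simultaneously.

A vertex has been visited exactly if its own frog no longer sleeps. A frog that jumps down to a
vertex that has already been visited is killed. If several frogs jump down to the
same unvisited vertex in the same round, only the one of lowest rank survives. Hence each subtree
that does not contain the root is entered from outside at most once. A sleeping frog wakes when its
site is visited; a first visit is always from above, since whenever a vertex has been visited, so
have all its ancestors. A frog that reaches the root is killed there. -/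
noncomputable def step {d : ℕ} (rank : Vertex d ↪ ℕ) (s : Config d)
    (a : Vertex d → Last d → Move d) : Config d := fun f =>
  match s f with
  | .asleep => if ∃ f', Descends s a f' f then .active f .start else .asleep
  | .active u m =>
    match a f m, u with
    | .down i, u =>
      if s (i :: u) = .asleep ∧ ∀ f', Descends s a f' (i :: u) → rank f ≤ rank f' then
        .active (i :: u) .cameDown
      else .dead
    | .up, c :: c' :: u' => .active (c' :: u') (.cameUp c)
    | .up, [_] => .atRoot
    | .up, [] => .dead -- an event of probability zero
  | .atRoot => .atRoot
  | .dead => .dead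

/-- The configuration at time `t`. -/
noncomputable def config {d : ℕ} (rank : Vertex d ↪ ℕ) (ω : Sample d) : ℕ → Config d
  | 0 => initial d
  | t + 1 => step rank (config rank ω t) (fun f m => ω (t, f, m))

/-- The total number of visits to the root. As frogs are killed at the root, it is
the number of frogs that ever get there; the initial presence of the root frog does not count. -/
noncomputable def visits {d : ℕ} (rank : Vertex d ↪ ℕ) (ω : Sample d) : ℕ∞ :=
  Set.encard {f : Vertex d | ∃ t, config rank ω t f = .atRoot}

/-- `x ^ n` for `x ∈ [0, 1)` and `n ∈ ℕ ∪ {∞}`, where `x ^ ∞ = 0`. -/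
noncomputable def powENat (x : ℝ) (n : ℕ∞) : ℝ := if n = ⊤ then 0 else x ^ n.toNat

/-- The probability generating function `x ↦ 𝔼 (x ^ V)` of the number `V` of visits to the root
in the self-similar frog model on the `d`-ary tree with drift parameter `p`. -/
noncomputable def genFun (d : ℕ) (hd : 2 ≤ d) (p : unitInterval) (rank : Vertex d ↪ ℕ) (x : ℝ) :
    ℝ :=
  ∫ ω, powENat x (visits rank ω) ∂(sampleLaw d hd p)

/-! ### The number of visits is a random variable -/

instance (d : ℕ) : MeasurableSpace (Status d) := ⊤

instance (d : ℕ) : DiscreteMeasurableSpace (Status d) := ⟨fun _ => trivial⟩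

instance (d : ℕ) : Countable (Status d) :=
  Function.Injective.countable
    (f := fun s : Status d => match s with
      | .asleep => (Sum.inl 0 : ℕ ⊕ (Vertex d × Last d))
      | .atRoot => Sum.inl 1
      | .dead => Sum.inl 2
      | .active u m => Sum.inr (u, m))
    (by intro s t; cases s <;> cases t <;> simp)

/-- A function is measurable if it is so on each level set of a discrete random variable. -/
theorem measurable_of_discrete {Ω C β : Type*} [MeasurableSpace Ω] [MeasurableSpace C] [Countable C]
    [DiscreteMeasurableSpace C] [MeasurableSpace β] {X : Ω → C} (hX : Measurable X) {Y : Ω → β}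
    (hY : ∀ c, ∃ G : Ω → β, Measurable G ∧ ∀ ω, X ω = c → Y ω = G ω) : Measurable Y := by
  choose G hG hYG using hY
  have h : Measurable fun q : C × Ω => G q.1 q.2 := measurable_from_prod_countable_right hG
  have e : Y = fun ω => G (X ω) ω := funext fun ω => hYG _ ω rfl
  rw [e]
  exact h.comp (hX.prodMk measurable_id)

theorem measurable_step {d : ℕ} (rank : Vertex d ↪ ℕ) {Ω : Type*} [MeasurableSpace Ω]
    (s : Ω → Config d) (a : Ω → Vertex d → Last d → Move d)
    (hs : ∀ f, Measurable fun ω => s ω f) (ha : ∀ f m, Measurable fun ω => a ω f m)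
    (f : Vertex d) : Measurable fun ω => step rank (s ω) (a ω) f := by
  classical
  have hS : ∀ f c, Measurable fun ω => s ω f = c := fun f c =>
    (measurable_from_top (f := fun σ : Status d => σ = c)).comp (hs f)
  have hA : ∀ f m c, Measurable fun ω => a ω f m = c := fun f m c =>
    (measurable_from_top (f := fun σ : Move d => σ = c)).comp (ha f m)
  have hD : ∀ f' w, Measurable fun ω => Descends (s ω) (a ω) f' w := fun f' w =>
    Measurable.exists fun u => Measurable.exists fun m => Measurable.exists fun i =>
      (hS _ _).and ((hA _ _ _).and measurable_const)
  have hE : Measurable fun ω => ∃ f', Descends (s ω) (a ω) f' f :=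
    Measurable.exists fun f' => hD f' f
  have hL : ∀ w, Measurable fun ω => s ω w = .asleep ∧
      ∀ f', Descends (s ω) (a ω) f' w → rank f ≤ rank f' := fun w =>
    (hS _ _).and (Measurable.forall fun f' => (hD f' w).imp measurable_const)
  refine measurable_of_discrete (hs f) fun σ => ?_
  cases σ with
  | asleep =>
    exact ⟨_, Measurable.ite (measurableSet_setOfPred.2 hE) measurable_const measurable_const,
      fun ω h => by simp only [step, h]; rfl⟩
  | atRoot => exact ⟨_, measurable_const, fun ω h => by simp only [step, h]; rfl⟩
  | dead => exact ⟨_, measurable_const, fun ω h => by simp only [step, h]; rfl⟩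
  | active u m =>
    refine ⟨fun ω => if s ω f = .active u m then step rank (s ω) (a ω) f else .dead, ?_,
      fun ω h => (if_pos h).symm⟩
    refine measurable_of_discrete (ha f m) fun b => ?_
    rcases b with _ | i
    · rcases u with _ | ⟨c, _ | ⟨c', u'⟩⟩
      · exact ⟨fun _ => .dead, measurable_const, fun ω hb => by
          by_cases h : s ω f = .active [] m <;> simp [step, h, hb]⟩
      · exact ⟨fun ω => if s ω f = .active [c] m then .atRoot else .dead,
          Measurable.ite (measurableSet_setOfPred.2 (hS _ _)) measurable_const measurable_const,
          fun ω hb => by by_cases h : s ω f = .active [c] m <;> simp [step, h, hb]⟩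
      · exact ⟨fun ω => if s ω f = .active (c :: c' :: u') m then
            .active (c' :: u') (.cameUp c) else .dead,
          Measurable.ite (measurableSet_setOfPred.2 (hS _ _)) measurable_const measurable_const,
          fun ω hb => by by_cases h : s ω f = .active (c :: c' :: u') m <;> simp [step, h, hb]⟩
    · exact ⟨fun ω => if s ω f = .active u m then (if s ω (i :: u) = .asleep ∧
            ∀ f', Descends (s ω) (a ω) f' (i :: u) → rank f ≤ rank f' then
            .active (i :: u) .cameDown else .dead) else .dead,
        Measurable.ite (measurableSet_setOfPred.2 (hS _ _))
          (Measurable.ite (measurableSet_setOfPred.2 (hL _)) measurable_const measurable_const)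
          measurable_const,
        fun ω hb => by by_cases h : s ω f = .active u m <;> simp [step, h, hb]⟩

theorem measurable_config {d : ℕ} (rank : Vertex d ↪ ℕ) (t : ℕ) (f : Vertex d) :
    Measurable fun ω : Sample d => config rank ω t f := by
  induction t generalizing f with
  | zero => exact measurable_const
  | succ t ih =>
    exact measurable_step rank _ _ ih (fun f m => measurable_pi_apply (t, f, m)) f

theorem measurable_visits {d : ℕ} (rank : Vertex d ↪ ℕ) :
    Measurable fun ω : Sample d => visits rank ω := by
  have hH : ∀ f : Vertex d, Measurable fun ω : Sample d => ∃ t, config rank ω t f = .atRoot :=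
    fun f => Measurable.exists fun t =>
      (measurable_from_top (f := fun σ : Status d => σ = .atRoot)).comp (measurable_config rank t f)
  have hge : ∀ n : ℕ, Measurable fun ω : Sample d => (n : ℕ∞) ≤ visits rank ω := by
    intro n
    have e : (fun ω : Sample d => (n : ℕ∞) ≤ visits rank ω) = fun ω =>
        ∃ F : Finset (Vertex d), F.card = n ∧ ∀ f, f ∈ F → ∃ t, config rank ω t f = .atRoot := by
      funext ω
      refine propext ⟨fun h => ?_, ?_⟩
      · obtain ⟨t, ht, hc⟩ := Set.exists_subset_encard_eq h
        have hf : t.Finite := Set.finite_of_encard_eq_coe hc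
        refine ⟨hf.toFinset, ?_, fun f hft => ht (hf.mem_toFinset.1 hft)⟩
        rw [hf.encard_eq_coe_toFinset_card] at hc
        exact_mod_cast hc
      · rintro ⟨F, rfl, hF⟩
        rw [← Set.encard_coe_eq_coe_finsetCard]
        exact Set.encard_le_encard fun f hf => hF f hf
    rw [e]
    exact Measurable.exists fun F => measurable_const.and
      (Measurable.forall fun f => measurable_const.imp (hH f))
  refine measurable_to_countable' fun n => ?_
  induction n using ENat.recTopCoe with
  | top =>
    have : (fun ω : Sample d => visits rank ω) ⁻¹' {⊤} = {ω | ∀ n : ℕ, (n : ℕ∞) ≤ visits rank ω} := by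
      ext ω
      exact (ENat.eq_top_iff_forall_ge (n := visits rank ω))
    rw [this]
    exact measurableSet_setOfPred.2 (Measurable.forall hge)
  | coe n =>
    have : (fun ω : Sample d => visits rank ω) ⁻¹' {(n : ℕ∞)} =
        {ω | (n : ℕ∞) ≤ visits rank ω ∧ ¬ ((n + 1 : ℕ) : ℕ∞) ≤ visits rank ω} := by
      ext ω
      change visits rank ω = n ↔ (n : ℕ∞) ≤ visits rank ω ∧ ¬ ((n + 1 : ℕ) : ℕ∞) ≤ visits rank ω
      induction visits rank ω using ENat.recTopCoe with
      | top => simp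
      | coe k => norm_cast; omega
    rw [this]
    exact measurableSet_setOfPred.2 ((hge n).and (hge (n + 1)).not)

/-! ## The operators -/

/-- The polynomial `P_k`, evaluated at `(z 1, …, z k)`: for `k ≥ 0`,
`P_{k+1} = z_{k+1}^{k+1} - ∑_{l=1}^{k} (k choose l-1) z_{k+1}^{k+1-l} P_l`
(below, `l = j + 1`). In particular `P_1 = z_1`. The value at `k = 0` is not used. -/
noncomputable def polyP (z : ℕ → ℝ) : ℕ → ℝ
  | 0 => 0
  | k + 1 => z (k + 1) ^ (k + 1) -
      ∑ j : Fin k, (k.choose j : ℝ) * z (k + 1) ^ (k - (j : ℕ)) * polyP z ((j : ℕ) + 1)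

/-- The polynomial `Q_k`, evaluated at `(z 1, …, z k)`: for `k ≥ 1`,
`Q_{k+1} = z_{k+1}^{k+1} - ∑_{l=2}^{k} (k-1 choose l-2) z_{k+1}^{k+1-l} Q_l`
(below, `k` is shifted by one, and `l = j + 2`). In particular `Q_2 = z_2 ^ 2`.
The values at `k = 0, 1` are not used. -/
noncomputable def polyQ (z : ℕ → ℝ) : ℕ → ℝ
  | 0 => 0
  | 1 => 0
  | k + 2 => z (k + 2) ^ (k + 2) -
      ∑ j : Fin k, (k.choose j : ℝ) * z (k + 2) ^ (k - (j : ℕ)) * polyQ z ((j : ℕ) + 2)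

/-- The domain `𝓘` of the operators: the nondecreasing functions `[0, 1) → [0, 1]`
(the values of `h` outside of `[0, 1)` play no role). -/
def domainI : Set (ℝ → ℝ) :=
  {h | Set.MapsTo h (Set.Ico 0 1) (Set.Icc 0 1) ∧ MonotoneOn h (Set.Ico 0 1)}

/-- The operator `𝓐_d`, for `d ≥ 2`, evaluated at `h ∈ 𝓘` and `x ∈ [0, 1)`. -/
noncomputable def opA (d : ℕ) (h : ℝ → ℝ) (x : ℝ) : ℝ :=
  let z : ℕ → ℝ := fun k => h (x / 2 + ((k : ℝ) - 1) / (2 * ((d : ℝ) - 1)))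
  (((d : ℝ) - 1) * x + 1) / (2 * d - 1) *
      ∑ k ∈ Finset.Icc 1 d, ((d - 1).choose (k - 1) : ℝ) * polyP z k +
    ((d : ℝ) - 1) / (2 * d - 1) *
      ∑ k ∈ Finset.Icc 2 d, ((d - 2).choose (k - 2) : ℝ) * polyQ z k

/-- The drift parameter `(d - 1) / (2 d - 1)`, as an element of `[0, 1]`. -/
noncomputable def drift (d : ℕ) (hd : 2 ≤ d) : unitInterval :=
  ⟨((d : ℝ) - 1) / (2 * d - 1), by
    have h2 : (2 : ℝ) ≤ d := by exact_mod_cast hd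
    exact ⟨div_nonneg (by linarith) (by linarith), (div_le_one (by linarith)).2 (by linarith)⟩⟩

end FrogModel

namespace FrogModel

open Finset fwdDiff

/-! The only fact about the frog model that is needed is that `V*` is a random variable with values
in ℕ ∪ {∞}. Its generating function `h` is then a mixture of powers, so all its finite differences
on [0, 1) are nonnegative. For such `h` the signs in the recursions of `P_k` and `Q_k` are only
apparent: both are cascade weights, i.e. sums of products of finite differences of `z`, hence
nonnegative. The recursion with `k = d`, read as `∑ C(d-1,k-1) z_d^(d-k) P_k = z_d^d`, then bounds
the sum without the powers of `z_d`: after removal of the term `k = 1`, each power is at least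
`z_d^(d-2)`, which cancels. This gives `∑ C(d-1,k-1) P_k ≤ s := z_1 + z_d^2 - z_d z_1`, and likewise
`∑ C(d-2,k-2) Q_k ≤ z_d^2`. Since `z_1 = h(x/2)` and `z_d = h(x/2 + 1/2)` for every `d`, these
bounds are exactly the sums for `d = 2`. Comparing the prefactors finishes the proof, because `s ≥
z_d^2`. The carrying lemmas are `sum_choose_mul_cascadeWeight`, `sum_polyP_le`, `sum_polyQ_le` and
`opA_le_opA_two`. -/

/-! ## Weights of activation cascades

A cascade on `m + u` subtrees starts with `m` activated ones, of which `f` have not been explored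
yet. If `z k` is the weight of the event that a subtree activates nothing outside of a
given set of `k` subtrees containing it, then `Δ_[1] ^[j] z m` is the weight of the event
that it activates exactly `j` given subtrees in addition to `m` given ones. -/

/-- The total weight of all cascades that activate all of the `u` remaining subtrees. -/
noncomputable def cascadeWeight (z : ℕ → ℝ) : ℕ → ℕ → ℕ → ℝ
  | _, 0, 0 => 1
  | _, 0, _ + 1 => 0
  | m, f + 1, u => ∑ j : Fin (u + 1),
      (u.choose j : ℝ) * Δ_[1] ^[(j : ℕ)] z m * cascadeWeight z (m + j) (f + j) (u - j)
termination_by _ f u => f + u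

theorem cascadeWeight_succ (z : ℕ → ℝ) (m f u : ℕ) :
    cascadeWeight z m (f + 1) u = ∑ j ∈ range (u + 1),
      (u.choose j : ℝ) * Δ_[1] ^[j] z m * cascadeWeight z (m + j) (f + j) (u - j) := by
  rw [cascadeWeight, Finset.sum_range]

/-- Each exploration lowers `f + u` by one and keeps `m + u`, so the induction only meets
differences supported on indices from 1 to `d`. -/
theorem cascadeWeight_nonneg {z : ℕ → ℝ} {d : ℕ}
    (hz : ∀ m j, 1 ≤ m → m + j ≤ d → 0 ≤ Δ_[1] ^[j] z m) (f u m : ℕ) (hm : 1 ≤ m)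
    (hd : m + u ≤ d) : 0 ≤ cascadeWeight z m f u := by
  induction hn : f + u using Nat.strong_induction_on generalizing f u m with
  | _ n ih =>
    rcases f with _ | f
    · rcases u with _ | u <;> simp [cascadeWeight]
    · rw [cascadeWeight_succ]
      refine sum_nonneg fun j hj => ?_
      have hj := mem_range.1 hj
      have h1 := hz m j hm (by omega)
      have h2 := ih _ (by omega) (f + j) (u - j) (m + j) (by omega) (by omega) rfl
      positivity

/-- The final set of activated subtrees within a set of `m + u` subtrees decomposes the event that
no subtree of the set activates anything outside of it. -/
theorem sum_choose_mul_cascadeWeight (z : ℕ → ℝ) (f u m : ℕ) :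
    ∑ i ∈ range (u + 1), (u.choose i : ℝ) * z (m + u) ^ (u - i) * cascadeWeight z m f i
      = z (m + u) ^ (f + u) := by
  induction hn : f + u using Nat.strong_induction_on generalizing f u m with
  | _ n ih =>
    rcases f with _ | f
    · rw [sum_range_succ']
      simp [cascadeWeight, ← hn]
    · have newton : z (m + u) = ∑ j ∈ range (u + 1), (u.choose j : ℝ) * Δ_[1] ^[j] z m := by
        simpa using shift_eq_sum_fwdDiff_iter 1 z u m
      have hpow : z (m + u) ^ n = z (m + u) * z (m + u) ^ (f + u) := by
        rw [← hn]; ring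
      rw [hpow]
      conv_rhs => rw [newton, sum_mul]
      -- The previous rewrite also expanded the base of the power; this folds it back.
      rw [← newton]
      simp only [cascadeWeight_succ, mul_sum]
      rw [sum_sigma', ← sum_congr rfl (fun j hj => ?_ : ∀ j ∈ range (u + 1),
        ∑ i ∈ range (u - j + 1), (u.choose j : ℝ) * Δ_[1] ^[j] z m *
          (((u - j).choose i : ℝ) * z (m + u) ^ (u - j - i) * cascadeWeight z (m + j) (f + j) i) =
        (u.choose j : ℝ) * Δ_[1] ^[j] z m * z (m + u) ^ (f + u))]
      · rw [sum_sigma']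
        -- Of the `i` subtrees activated in the end, `j` are activated by the first exploration and
        -- `i - j` later.
        refine sum_bij' (fun q _ => ⟨q.2, q.1 - q.2⟩) (fun q _ => ⟨q.1 + q.2, q.1⟩) ?_ ?_ ?_ ?_ ?_
        · rintro ⟨i, j⟩ h; simp at h ⊢; omega
        · rintro ⟨i, j⟩ h; simp at h ⊢; omega
        · rintro ⟨i, j⟩ h; simp at h ⊢; omega
        · rintro ⟨i, j⟩ h; simp at h ⊢
        · rintro ⟨i, j⟩ h
          simp only [mem_sigma, mem_range] at h
          have hc : (u.choose i : ℝ) * i.choose j = u.choose j * (u - j).choose (i - j) := by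
            exact_mod_cast Nat.choose_mul (n := u) (k := i) (s := j) (by omega)
          have he : u - j - (i - j) = u - i := by omega
          simp only [he]
          linear_combination z (m + u) ^ (u - i) * Δ_[1] ^[j] z m *
            cascadeWeight z (m + j) (f + j) (i - j) * hc
      · have hj := mem_range.1 hj
        have := ih (f + j + (u - j)) (by omega) (f + j) (u - j) (m + j) rfl
        rw [show m + j + (u - j) = m + u by omega, show f + j + (u - j) = f + u by omega] at this
        rw [← mul_sum, this]

/-- The term `i = u` of `sum_choose_mul_cascadeWeight` has coefficient 1; solving for it reproduces
the recursion of `polyP`. -/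
theorem polyP_succ_eq_cascadeWeight (z : ℕ → ℝ) (u : ℕ) :
    polyP z (u + 1) = cascadeWeight z 1 1 u := by
  induction u using Nat.strong_induction_on with
  | _ u ih =>
    have h := sum_choose_mul_cascadeWeight z 1 u 1
    rw [sum_range_succ, sum_range] at h
    rw [polyP, sum_congr rfl fun j _ => by rw [ih j j.2], add_comm u 1, ← h]
    simp

theorem polyQ_add_two_eq_cascadeWeight (z : ℕ → ℝ) (u : ℕ) :
    polyQ z (u + 2) = cascadeWeight z 2 2 u := by
  induction u using Nat.strong_induction_on with
  | _ u ih =>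
    have h := sum_choose_mul_cascadeWeight z 2 u 2
    rw [sum_range_succ, sum_range] at h
    rw [polyQ, sum_congr rfl fun j _ => by rw [ih j j.2], add_comm u 2, ← h]
    simp

/-! ## Bounds for the sums of polynomials -/

/-- Every factor `y ^ (e - u)` is at least `y ^ e`, which can be cancelled. -/
theorem sum_le_of_sum_mul_pow_eq {e : ℕ} {b : ℕ → ℝ} {c y : ℝ} (hb : ∀ u ≤ e, 0 ≤ b u)
    (hy : 0 < y) (hy1 : y ≤ 1) (h : ∑ u ∈ range (e + 1), b u * y ^ (e - u) = y ^ e * c) :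
    ∑ u ∈ range (e + 1), b u ≤ c := by
  refine le_of_mul_le_mul_left ?_ (pow_pos hy e)
  rw [← h, mul_sum]
  refine sum_le_sum fun u hu => ?_
  rw [mul_comm]
  exact mul_le_mul_of_nonneg_left (pow_le_pow_of_le_one hy.le hy1 (Nat.sub_le e u))
    (hb u (by have := mem_range.1 hu; omega))

/-- The term `k = 1` carries the top power `z (e + 2) ^ (e + 1)`. Splitting it off leaves exponents
at most `e`, which makes the bound sharp for `e = 0`. -/
theorem sum_polyP_le {z : ℕ → ℝ} {e : ℕ}
    (hz : ∀ m j, 1 ≤ m → m + j ≤ e + 2 → 0 ≤ Δ_[1] ^[j] z m)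
    (hpos : 0 < z (e + 2)) (hle : z (e + 2) ≤ 1) :
    ∑ k ∈ Icc 1 (e + 2), ((e + 1).choose (k - 1) : ℝ) * polyP z k
      ≤ z 1 + z (e + 2) ^ 2 - z (e + 2) * z 1 := by
  have h := sum_choose_mul_cascadeWeight z 1 (e + 1) 1
  have h0 : cascadeWeight z 1 1 0 = z 1 := by simp [cascadeWeight]
  rw [sum_range_succ', h0, show 1 + (e + 1) = e + 2 by ring] at h
  have key : ∑ u ∈ range (e + 1), ((e + 1).choose (u + 1) : ℝ) * cascadeWeight z 1 1 (u + 1)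
      ≤ z (e + 2) ^ 2 - z (e + 2) * z 1 := by
    refine sum_le_of_sum_mul_pow_eq (fun u hu => mul_nonneg (Nat.cast_nonneg _)
      (cascadeWeight_nonneg hz 1 (u + 1) 1 le_rfl (by omega))) hpos hle ?_
    have : ∑ u ∈ range (e + 1), ((e + 1).choose (u + 1) : ℝ) * cascadeWeight z 1 1 (u + 1)
        * z (e + 2) ^ (e - u) = ∑ u ∈ range (e + 1), ((e + 1).choose (u + 1) : ℝ)
          * z (e + 2) ^ (e + 1 - (u + 1)) * cascadeWeight z 1 1 (u + 1) :=
      sum_congr rfl fun u _ => by rw [Nat.add_sub_add_right]; ring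
    rw [this, eq_sub_of_add_eq h]
    simp only [Nat.choose_zero_right, Nat.cast_one, Nat.sub_zero]
    ring
  rw [← Finset.Ico_add_one_right_eq_Icc, sum_Ico_eq_sum_range]
  simp only [Nat.add_sub_cancel, add_comm 1, polyP_succ_eq_cascadeWeight]
  rw [sum_range_succ', h0]
  simp only [Nat.choose_zero_right, Nat.cast_one]
  linarith

theorem sum_polyQ_le {z : ℕ → ℝ} {e : ℕ}
    (hz : ∀ m j, 1 ≤ m → m + j ≤ e + 2 → 0 ≤ Δ_[1] ^[j] z m)
    (hpos : 0 < z (e + 2)) (hle : z (e + 2) ≤ 1) :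
    ∑ k ∈ Icc 2 (e + 2), (e.choose (k - 2) : ℝ) * polyQ z k ≤ z (e + 2) ^ 2 := by
  have h := sum_choose_mul_cascadeWeight z 2 e 2
  rw [add_comm 2 e] at h
  rw [← Finset.Ico_add_one_right_eq_Icc, sum_Ico_eq_sum_range]
  simp only [Nat.add_sub_cancel, add_comm 2, polyQ_add_two_eq_cascadeWeight]
  rw [show e + 2 + 1 - 2 = e + 1 by omega]
  refine sum_le_of_sum_mul_pow_eq (fun u hu => mul_nonneg (Nat.cast_nonneg _)
    (cascadeWeight_nonneg hz 2 u 2 (by omega) (by omega))) hpos hle ?_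
  rw [← pow_add, ← h]
  exact sum_congr rfl fun u _ => by ring

/-- Every term of the recursion contains a positive power of `z k`. This serves the degenerate case
in which no power of `z_d` can be cancelled. -/
theorem polyP_eq_zero {z : ℕ → ℝ} {k : ℕ} (h : z k = 0) : polyP z k = 0 := by
  rcases k with _ | k
  · rw [polyP]
  · rw [polyP, h, zero_pow k.succ_ne_zero, zero_sub, neg_eq_zero]
    exact sum_eq_zero fun j _ => by
      rw [zero_pow (Nat.sub_ne_zero_of_lt j.2), mul_zero, zero_mul]

theorem polyQ_eq_zero {z : ℕ → ℝ} {k : ℕ} (h : z k = 0) : polyQ z k = 0 := by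
  rcases k with _ | _ | k
  · rw [polyQ]
  · rw [polyQ]
  · rw [polyQ, h, zero_pow (by omega), zero_sub, neg_eq_zero]
    exact sum_eq_zero fun j _ => by
      rw [zero_pow (Nat.sub_ne_zero_of_lt j.2), mul_zero, zero_mul]

/-! ## Comparison of the operators -/

/-- `Δ^j h (a + i δ) ≥ 0` for all arithmetic progressions in `[0, 1)`. -/
def AbsolutelyMonotone (h : ℝ → ℝ) : Prop :=
  ∀ (δ y : ℝ) (j : ℕ), 0 ≤ δ → 0 ≤ y → y + j * δ < 1 → 0 ≤ Δ_[δ] ^[j] h y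

theorem opA_two (h : ℝ → ℝ) (x : ℝ) :
    opA 2 h x = (x + 1) / 3 * (h (x / 2) + h (x / 2 + 1 / 2) ^ 2
      - h (x / 2 + 1 / 2) * h (x / 2)) + 1 / 3 * h (x / 2 + 1 / 2) ^ 2 := by
  have hP1 (z : ℕ → ℝ) : polyP z 1 = z 1 := by rw [polyP]; simp
  have hP2 (z : ℕ → ℝ) : polyP z 2 = z 2 ^ 2 - z 2 * z 1 := by rw [polyP]; simp [hP1]
  have hQ2 (z : ℕ → ℝ) : polyQ z 2 = z 2 ^ 2 := by rw [polyQ]; simp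
  have h1 : Icc 1 2 = {1, 2} := rfl
  rw [opA]
  simp only [h1, Icc_self, sum_singleton, sum_pair (show (1 : ℕ) ≠ 2 by decide), hP1, hP2, hQ2,
    Nat.reduceSub, Nat.choose_zero_right, Nat.choose_self, Nat.cast_one, Nat.cast_ofNat]
  ring_nf

theorem fwdDiff_iter_comp_arith (h : ℝ → ℝ) (a δ : ℝ) (j m : ℕ) :
    Δ_[1] ^[j] (fun k : ℕ => h (a + k * δ)) m = Δ_[δ] ^[j] h (a + m * δ) := by
  rw [fwdDiff_iter_eq_sum_shift, fwdDiff_iter_eq_sum_shift]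
  refine sum_congr rfl fun i _ => ?_
  congr 2
  simp only [smul_eq_mul, mul_one, Nat.cast_add, nsmul_eq_mul]
  ring

theorem opA_le_opA_two {h : ℝ → ℝ} (hI : h ∈ domainI) (hA : AbsolutelyMonotone h) {d : ℕ}
    (hd : 2 ≤ d) {x : ℝ} (hx : x ∈ Set.Ico (0 : ℝ) 1) : opA d h x ≤ opA 2 h x := by
  obtain ⟨hx0, hx1⟩ := hx
  obtain ⟨e, rfl⟩ := Nat.exists_eq_add_of_le' hd
  rw [opA_two]
  have he : (0 : ℝ) ≤ e := Nat.cast_nonneg e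
  set z : ℕ → ℝ := fun k => h (x / 2 + ((k : ℝ) - 1) / (2 * (((e + 2 : ℕ) : ℝ) - 1))) with hzdef
  have hop : opA (e + 2) h x = ((e + 1) * x + 1) / (2 * e + 3) *
      ∑ k ∈ Icc 1 (e + 2), ((e + 1).choose (k - 1) : ℝ) * polyP z k +
    (e + 1) / (2 * e + 3) * ∑ k ∈ Icc 2 (e + 2), (e.choose (k - 2) : ℝ) * polyQ z k := by
    have e1 : (((e + 2 : ℕ) : ℝ) - 1) = e + 1 := by push_cast; ring
    have e2 : (2 * ((e + 2 : ℕ) : ℝ) - 1) = 2 * e + 3 := by push_cast; ring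
    have e3 : e + 2 - 1 = e + 1 := rfl
    rw [opA]
    simp only [e2, e3, Nat.add_sub_cancel, hzdef]
    simp only [e1]
  set δ : ℝ := 1 / (2 * (e + 1)) with hδ
  have hδ0 : 0 ≤ δ := by positivity
  have hδe : (e + 1) * δ = 1 / 2 := by rw [hδ]; field_simp
  -- Indices start at 1, so the progression is based at `x / 2 - δ`. This point may be negative, but
  -- only `k ≥ 1` is used.
  have hzeq : z = fun k : ℕ => h ((x / 2 - δ) + k * δ) := by
    funext k
    simp only [hzdef, hδ]
    congr 1
    push_cast
    have : (e : ℝ) + 2 - 1 = e + 1 := by ring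
    rw [this]
    ring
  have hz : ∀ m j, 1 ≤ m → m + j ≤ e + 2 → 0 ≤ Δ_[1] ^[j] z m := by
    intro m j hm hmj
    rw [hzeq, fwdDiff_iter_comp_arith]
    have hm' : (1 : ℝ) ≤ m := by exact_mod_cast hm
    have hmj' : (m : ℝ) + j ≤ e + 2 := by exact_mod_cast hmj
    -- The last point is at most `x / 2 + (e + 1) * δ = x / 2 + 1 / 2 < 1`.
    exact hA _ _ _ hδ0 (by nlinarith) (by nlinarith)
  have hz1 : z 1 = h (x / 2) := by simp [hzdef]
  have hz2 : z (e + 2) = h (x / 2 + 1 / 2) := by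
    rw [hzeq]
    simp only
    congr 1
    push_cast
    linarith
  have m1 := hI.1 (show x / 2 ∈ Set.Ico (0 : ℝ) 1 from ⟨by linarith, by linarith⟩)
  have m2 := hI.1 (show x / 2 + 1 / 2 ∈ Set.Ico (0 : ℝ) 1 from ⟨by linarith, by linarith⟩)
  rw [hop, ← hz1, ← hz2]
  rw [← hz1] at m1
  rw [← hz2] at m2
  obtain ⟨m1, m1'⟩ := m1
  obtain ⟨m2, m2'⟩ := m2
  rcases m2.eq_or_lt with h0 | hpos
  -- If `z_d = 0`, monotonicity forces all `z_k` to vanish.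
  · have hzero : ∀ k ∈ Icc 1 (e + 2), z k = 0 := by
      intro k hk
      obtain ⟨hk1, hk2⟩ := mem_Icc.1 hk
      have hk1' : (1 : ℝ) ≤ k := by exact_mod_cast hk1
      have hk2' : (k : ℝ) ≤ e + 2 := by exact_mod_cast hk2
      have a0 : 0 ≤ x / 2 - δ + k * δ := by nlinarith
      have a1 : x / 2 - δ + k * δ ≤ x / 2 + 1 / 2 := by nlinarith
      have b := hI.2 (show x / 2 - δ + k * δ ∈ Set.Ico (0 : ℝ) 1 from ⟨a0, by linarith⟩)
        (show x / 2 + 1 / 2 ∈ Set.Ico (0 : ℝ) 1 from ⟨by linarith, by linarith⟩) a1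
      have c := (hI.1 (show x / 2 - δ + k * δ ∈ Set.Ico (0 : ℝ) 1 from ⟨a0, by linarith⟩)).1
      rw [← hz2, ← h0] at b
      rw [hzeq]
      exact le_antisymm b c
    rw [sum_eq_zero fun k hk => by rw [polyP_eq_zero (hzero k hk), mul_zero],
      sum_eq_zero fun k hk => by
        rw [polyQ_eq_zero (hzero k (Icc_subset_Icc_left one_le_two hk)), mul_zero], ← h0]
    have : 0 ≤ (x + 1) / 3 * z 1 := by positivity
    linarith
  · have hP := sum_polyP_le hz hpos m2'
    have hQ := sum_polyQ_le hz hpos m2'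
    set s := z 1 + z (e + 2) ^ 2 - z (e + 2) * z 1
    have hs : z (e + 2) ^ 2 ≤ s := by
      have := mul_nonneg m1 (sub_nonneg.2 m2')
      simp only [s]; linarith
    have hs0 : 0 ≤ s := (sq_nonneg _).trans hs
    calc _ ≤ ((e + 1) * x + 1) / (2 * e + 3) * s + (e + 1) / (2 * e + 3) * z (e + 2) ^ 2 := by
          gcongr
      -- Relative to `d = 2`, the prefactor of `s` drops by `e (2 - x) / (3 (2 e + 3))` and that of
      -- `z_d^2` grows by `e / (3 (2 e + 3))`.
      _ = (x + 1) / 3 * s + 1 / 3 * z (e + 2) ^ 2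
          - e / (3 * (2 * e + 3)) * ((1 - x) * s + (s - z (e + 2) ^ 2)) := by
        field_simp
        ring
      _ ≤ _ := by
        have : 0 ≤ e / (3 * (2 * e + 3)) * ((1 - x) * s + (s - z (e + 2) ^ 2)) :=
          mul_nonneg (by positivity) (add_nonneg (mul_nonneg (by linarith) hs0) (by linarith))
        linarith

/-! ## Probability generating functions -/

/-- By the binomial theorem one difference of `t ^ n` is a nonnegative combination of lower powers,
so the induction on `j` runs over all `n` at once. -/
theorem fwdDiff_iter_pow_nonneg {δ : ℝ} (hδ : 0 ≤ δ) (j n : ℕ) {y : ℝ} (hy : 0 ≤ y) :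
    0 ≤ Δ_[δ] ^[j] (fun t : ℝ => t ^ n) y := by
  induction j generalizing n y with
  | zero => simpa using pow_nonneg hy n
  | succ j ih =>
    have h : Δ_[δ] (fun t : ℝ => t ^ n)
        = ∑ i ∈ range n, (δ ^ (n - i) * n.choose i) • fun t : ℝ => t ^ i := by
      funext t
      rw [fwdDiff, add_pow, sum_range_succ]
      simp only [Finset.sum_apply, Pi.smul_apply, smul_eq_mul, Nat.sub_self, Nat.choose_self,
        pow_zero, Nat.cast_one, mul_one, add_sub_cancel_right]
      exact sum_congr rfl fun i _ => by ring
    rw [Function.iterate_succ_apply, h, fwdDiff_iter_finsetSum]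
    simp only [Finset.sum_apply, fwdDiff_iter_const_smul, Pi.smul_apply, smul_eq_mul]
    exact sum_nonneg fun i _ => mul_nonneg (by positivity) (ih i hy)

theorem fwdDiff_iter_powENat_nonneg {δ : ℝ} (hδ : 0 ≤ δ) (j : ℕ) (n : ℕ∞) {y : ℝ} (hy : 0 ≤ y) :
    0 ≤ Δ_[δ] ^[j] (fun t : ℝ => powENat t n) y := by
  by_cases hn : n = ⊤
  · rw [fwdDiff_iter_eq_sum_shift]
    simp [powENat, hn]
  · simpa only [powENat, hn, if_false] using fwdDiff_iter_pow_nonneg hδ j n.toNat hy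

theorem powENat_mem_Icc {x : ℝ} (hx : x ∈ Set.Ico (0 : ℝ) 1) (n : ℕ∞) :
    powENat x n ∈ Set.Icc (0 : ℝ) 1 := by
  rw [powENat]
  split_ifs
  · exact ⟨le_rfl, zero_le_one⟩
  · exact ⟨pow_nonneg hx.1 _, pow_le_one₀ hx.1 hx.2.le⟩

theorem powENat_le_powENat {x y : ℝ} (hx : 0 ≤ x) (hxy : x ≤ y) (n : ℕ∞) :
    powENat x n ≤ powENat y n := by
  rw [powENat, powENat]
  split_ifs
  · exact le_rfl
  · exact pow_le_pow_left₀ hx hxy _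

section PGF

variable {Ω : Type*} [MeasurableSpace Ω] {μ : Measure Ω} [IsProbabilityMeasure μ] {V : Ω → ℕ∞}

theorem integrable_powENat (hV : Measurable V) {x : ℝ} (hx : x ∈ Set.Ico (0 : ℝ) 1) :
    Integrable (fun ω => powENat x (V ω)) μ := by
  refine Integrable.of_bound ((measurable_of_countable (powENat x)).comp hV).aestronglyMeasurable 1
    (Filter.Eventually.of_forall fun ω => ?_)
  have := powENat_mem_Icc hx (V ω)
  rw [Real.norm_eq_abs, abs_of_nonneg this.1]
  exact this.2

theorem integral_powENat_mem_domainI (hV : Measurable V) :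
    (fun x => ∫ ω, powENat x (V ω) ∂μ) ∈ domainI := by
  refine ⟨fun x hx => ⟨integral_nonneg fun ω => (powENat_mem_Icc hx _).1, ?_⟩,
    fun x hx y hy hxy => integral_mono (integrable_powENat hV hx) (integrable_powENat hV hy)
      fun ω => powENat_le_powENat hx.1 hxy _⟩
  calc ∫ ω, powENat x (V ω) ∂μ ≤ ∫ _, (1 : ℝ) ∂μ :=
        integral_mono (integrable_powENat hV hx) (integrable_const 1)
          fun ω => (powENat_mem_Icc hx _).2
    _ = 1 := by simp

/-- A finite difference is a finite linear combination of values, here at points of [0, 1) where the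
integrands are bounded, so it passes under the expectation. -/
theorem absolutelyMonotone_integral_powENat (hV : Measurable V) :
    AbsolutelyMonotone fun x => ∫ ω, powENat x (V ω) ∂μ := by
  intro δ y j hδ hy hj
  have hmem : ∀ i ∈ range (j + 1), y + i • δ ∈ Set.Ico (0 : ℝ) 1 := by
    intro i hi
    have hij : (i : ℝ) ≤ j := by exact_mod_cast Nat.lt_succ_iff.1 (mem_range.1 hi)
    rw [nsmul_eq_mul]
    exact ⟨by positivity, by nlinarith⟩
  have e : Δ_[δ] ^[j] (fun x => ∫ ω, powENat x (V ω) ∂μ) y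
      = ∫ ω, Δ_[δ] ^[j] (fun x => powENat x (V ω)) y ∂μ := by
    simp only [fwdDiff_iter_eq_sum_shift, zsmul_eq_mul]
    rw [integral_finsetSum _ fun i hi => (integrable_powENat hV (hmem i hi)).const_mul _]
    exact sum_congr rfl fun i _ => (integral_const_mul _ _).symm
  rw [e]
  exact integral_nonneg fun ω => fwdDiff_iter_powENat_nonneg hδ j _ hy

end PGF

end FrogModel

theorem proposition4p1 (d : ℕ) (hd : 2 ≤ d) (rank : FrogModel.Vertex d ↪ ℕ) :
    FrogModel.genFun d hd (FrogModel.drift d hd) rank ∈ FrogModel.domainI ∧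
      ∀ x ∈ Set.Ico (0 : ℝ) 1,
        FrogModel.opA d (FrogModel.genFun d hd (FrogModel.drift d hd) rank) x ≤
          FrogModel.opA 2 (FrogModel.genFun d hd (FrogModel.drift d hd) rank) x := by
  have : IsProbabilityMeasure (FrogModel.sampleLaw d hd (FrogModel.drift d hd)) := by
    unfold FrogModel.sampleLaw
    infer_instance
  have hV := FrogModel.measurable_visits rank
  have hI : FrogModel.genFun d hd (FrogModel.drift d hd) rank ∈ FrogModel.domainI :=
    FrogModel.integral_powENat_mem_domainI hV
  exact ⟨hI, fun x hx => FrogModel.opA_le_opA_two hI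
    (FrogModel.absolutelyMonotone_integral_powENat hV) hd hx⟩
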